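/- Fix a signature $\mathcal F$ and an infinite countable set $\mathcal V$ of variables; $\mathcal T=\mathcal T(\mathcal F,\mathcal V)$ is the set of terms, and $\mathcal{V}ar(\cdot)$ denotes the set of variables occurring in the listed terms. A conditional term rewrite system (CTRS) $\mathcal R$ is a set of rules $\alpha: l\to r\Leftarrow s_1\to^* t_1,\dots,s_k\to^* t_k$ ($k\ge 0$) over $\mathcal T$. Put $\mathcal R_0=\emptyset$ and let $\mathcal R_{n+1}$ be the set of all $l\sigma\to r\sigma$ with $\alpha\in\mathcal R$ and $\sigma$ a substitution such that $s_i\sigma\to^*_{\mathcal R_n}t_i\sigma$ for all $i$; then $u\to_{\mathcal R}v$ means $u\to_{\mathcal R_n}v$ for some $n$. The system $\mathcal R$ is a DCTRS if for every rule $\mathcal{V}ar(r)\subseteq \mathcal{V}ar(l,s_1,t_1,\dots,s_k,t_k)$ and $\mathcal{V}ar(s_i)\subseteq\mathcal{V}ar(l,t_1,\dots,t_{i-1})$ for all $i$. It is right-stable if for every rule and every $i$, $t_i$ is either a linear constructor term (no variable occurs twice, and no symbol is the root of a left-hand side of $\mathcal R$) or a ground term that is irreducible with respect to $\{l\to r\mid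 (l\to r\Leftarrow c)\in\mathcal R\}$, and $\mathcal{V}ar(t_i)\cap\mathcal{V}ar(l,s_1,t_1,\dots,s_{i-1},t_{i-1},s_i)=\emptyset$. For a finite set $X$ of variables let $\vec X$ be the sequence of its elements in an arbitrary but fixed order. The sequential unraveling $U_{seq}(\mathcal R)$ is the unconditional system obtained by keeping the rules with $k=0$ and replacing each rule $\alpha$ with $k\ge 1$ by $$l\to U^\alpha_1(s_1,\vec X_1),\qquad U^\alpha_i(t_i,\vec X_i)\to U^\alpha_{i+1}(s_{i+1},\vec X_{i+1})\ (1\le i<k),\qquad U^\alpha_k(t_k,\vec X_k)\to r,$$ where $X_i=\mathcal{V}ar(l,t_1,\dots,t_{i-1})$ and the $U^\alpha_i$ are new, pairwise distinct function symbols. Its signature consists of $\mathcal F$ and the symbols $U^\alpha_i$; a term over it is original if it lies in $\mathcal T$. The back-translation $\mathsf{tb}$ maps terms over this signature to $\mathcal T$: $\mathsf{tb}(x)=x$ for a variable $x$, $\mathsf{tb}(f(a_1,\dots,a_n))=f(\mathsf{tb}(a_1),\dots,\mathsf{tb}(a_n))$ for $f\in\mathcal F$, and $\mathsf{tb}(U^\alpha_i(w,v_1,\dots,v_m))=l\sigma$,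 where $l$ is the left-hand side of $\alpha$, $\vec X_i=x_1,\dots,x_m$ and $x_j\sigma=\mathsf{tb}(v_j)$. **Theorem.** Let $\mathcal R$ be a right-stable DCTRS such that $U_{seq}(\mathcal R)$ is confluent and terminating. Then $U_{seq}$ is sound for reductions to normal forms: if $u\to^*_{U_{seq}(\mathcal R)}v$, where $u\in\mathcal T$ is original and $v$ is a normal form of $U_{seq}(\mathcal R)$, then $u\to^*_{\mathcal R}\mathsf{tb}(v)$. -/

import Mathlib

open FirstOrder

/-! Terms over a signature `F` with variables in `V` are the first-order terms `L.Term V` of a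
language `L`; the function symbols of `L` with their arities are the signature, and the relation
symbols of `L` play no role. -/

namespace CTRS

section Rewriting

variable {L : Language} {V : Type*}

/-- The one-step rewrite relation of a set of unconditional rules: the closure of the rules under
substitutions and contexts. -/
inductive Step (S : Set (L.Term V × L.Term V)) : L.Term V → L.Term V → Prop
  | rule {l r : L.Term V} (h : (l, r) ∈ S) (σ : V → L.Term V) : Step S (l.subst σ) (r.subst σ)
  | arg {n : ℕ} (f : L.Functions n) (ts : Fin n → L.Term V) (i : Fin n) {t' : L.Term V}
      (h : Step S (ts i) t') :
      Step S (Language.Term.func f ts) (Language.Term.func f (Function.update ts i t'))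

/-- `Steps S` is the reflexive and transitive closure of the rewrite relation. -/
def Steps (S : Set (L.Term V × L.Term V)) : L.Term V → L.Term V → Prop :=
  Relation.ReflTransGen (Step S)

/-- Irreducible terms. -/
def IsNormalForm (S : Set (L.Term V × L.Term V)) (t : L.Term V) : Prop :=
  ∀ t', ¬ Step S t t'

def Confluent (S : Set (L.Term V × L.Term V)) : Prop :=
  ∀ s t t', Steps S s t → Steps S s t' → ∃ w, Steps S t w ∧ Steps S t' w

/-- There is no infinite rewrite sequence. -/
def Terminating (S : Set (L.Term V × L.Term V)) : Prop :=
  ¬ ∃ f : ℕ → L.Term V, ∀ n, Step S (f n) (f (n + 1))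

end Rewriting

/-- An oriented conditional rule `lhs → rhs ⇐ s₁ →* t₁, …, sₖ →* tₖ`, where `conds` is the list of
the pairs `(sᵢ, tᵢ)`. The rule is unconditional if this list is empty. -/
structure Rule (L : Language) (V : Type*) where
  lhs : L.Term V
  rhs : L.Term V
  conds : List (L.Term V × L.Term V)

section Conditional

variable {L : Language} {V : Type*}

/-- The number of occurrences of the variable `x` in a term. -/
def occ [DecidableEq V] (x : V) : L.Term V → ℕ
  | .var y => if y = x then 1 else 0
  | .func _ ts => ∑ i, occ x (ts i)

/-- No variable occurs more than once. -/
def IsLinear [DecidableEq V] (t : L.Term V) : Prop := ∀ x, occ x t ≤ 1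

/-- `f` is a defined symbol of `R` if it is the root symbol of some left-hand side. -/
def IsDefined (R : Set (Rule L V)) {n : ℕ} (f : L.Functions n) : Prop :=
  ∃ α ∈ R, ∃ ts, α.lhs = Language.Term.func f ts

/-- Terms without defined symbols. -/
inductive IsConstructorTerm (R : Set (Rule L V)) : L.Term V → Prop
  | var (x : V) : IsConstructorTerm R (Language.Term.var x)
  | func {n : ℕ} (f : L.Functions n) (ts : Fin n → L.Term V) (hf : ¬ IsDefined R f)
      (hts : ∀ i, IsConstructorTerm R (ts i)) : IsConstructorTerm R (Language.Term.func f ts)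

/-- The underlying unconditional system, obtained by dropping the conditions. -/
def underlying (R : Set (Rule L V)) : Set (L.Term V × L.Term V) :=
  {p | ∃ α ∈ R, p = (α.lhs, α.rhs)}

/-- The unconditional systems `R₀ = ∅`,
`Rₙ₊₁ = {lσ → rσ | (l → r ⇐ c) ∈ R and sσ →* tσ in Rₙ for all (s, t) in c}`. -/
def level (R : Set (Rule L V)) : ℕ → Set (L.Term V × L.Term V)
  | 0 => ∅
  | n + 1 => {p | ∃ α ∈ R, ∃ σ : V → L.Term V, p = (α.lhs.subst σ, α.rhs.subst σ) ∧
      ∀ c ∈ α.conds, Steps (level R n) (c.1.subst σ) (c.2.subst σ)}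

/-- The one-step rewrite relation of a conditional system. -/
def CStep (R : Set (Rule L V)) (s t : L.Term V) : Prop := ∃ n, Step (level R n) s t

/-- The reflexive and transitive closure of the rewrite relation of a conditional system. -/
def CSteps (R : Set (Rule L V)) : L.Term V → L.Term V → Prop :=
  Relation.ReflTransGen (CStep R)

variable [DecidableEq V]

/-- The variables of `l, t₁, …, tᵢ` (the left-hand side and the right-hand sides of the first `i`
conditions). -/
def Rule.boundVars (α : Rule L V) (i : ℕ) : Finset V :=
  α.lhs.varFinset ∪ (α.conds.take i).foldr (fun c X => c.2.varFinset ∪ X) ∅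

/-- The variables of all conditions. -/
def Rule.condVars (α : Rule L V) : Finset V :=
  α.conds.foldr (fun c X => c.1.varFinset ∪ c.2.varFinset ∪ X) ∅

/-- Deterministic rule: every variable of the right-hand side occurs in the left-hand side or in
the conditions (type 3), and `Var(sᵢ) ⊆ Var(l, t₁, …, tᵢ₋₁)`. Conditions are indexed from `0`. -/
def Rule.IsDeterministic (α : Rule L V) : Prop :=
  α.rhs.varFinset ⊆ α.condVars ∪ α.lhs.varFinset ∧
    ∀ i : Fin α.conds.length, (α.conds.get i).1.varFinset ⊆ α.boundVars i

/-- Deterministic conditional term rewrite systems. -/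
def IsDCTRS (R : Set (Rule L V)) : Prop := ∀ α ∈ R, α.IsDeterministic

/-- Right-stability: every `tᵢ` is a linear constructor term or a ground term that is irreducible
in the underlying system, and shares no variable with `l, s₁, t₁, …, sᵢ₋₁, tᵢ₋₁, sᵢ`. -/
def IsRightStable (R : Set (Rule L V)) : Prop :=
  ∀ α ∈ R, ∀ i : Fin α.conds.length,
    ((IsLinear (α.conds.get i).2 ∧ IsConstructorTerm R (α.conds.get i).2) ∨
      ((α.conds.get i).2.varFinset = ∅ ∧ IsNormalForm (underlying R) (α.conds.get i).2)) ∧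
    Disjoint (α.conds.get i).2.varFinset α.lhs.varFinset ∧
    (∀ j ≤ i, Disjoint (α.conds.get i).2.varFinset (α.conds.get j).1.varFinset) ∧
    (∀ j < i, Disjoint (α.conds.get i).2.varFinset (α.conds.get j).2.varFinset)

end Conditional

/-- An arbitrary but fixed way to list the elements of each finite set of variables without
repetition. -/
structure Enumeration (V : Type*) where
  list : Finset V → List V
  nodup : ∀ X, (list X).Nodup
  mem_list : ∀ X x, x ∈ list X ↔ x ∈ X

section Unraveling

variable {L : Language} {V : Type*} [DecidableEq V]

/-- The sequence of the variables of `l, t₁, …, tᵢ`. For the condition with the `0`-based index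
`i` these are the variables that the corresponding U-symbol stores. -/
def uVars (e : Enumeration V) (α : Rule L V) (i : ℕ) : List V := e.list (α.boundVars i)

/-- The U-symbols: one for each rule of `R` and each condition of it. The arguments are the
conditional argument followed by the variable arguments. -/
inductive USymbol (R : Set (Rule L V)) (e : Enumeration V) : ℕ → Type _
  | mk (α : R) (i : Fin α.1.conds.length) : USymbol R e ((uVars e α.1 i).length + 1)

/-- The signature of the unraveled system: the original symbols and the U-symbols. -/
def uLang (R : Set (Rule L V)) (e : Enumeration V) : Language :=
  L.sum ⟨USymbol R e, fun _ => Empty⟩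

/-- The inclusion of original terms into the terms over the signature of the unraveled system. The
terms in its range are the original ones. -/
def orig (R : Set (Rule L V)) (e : Enumeration V) (t : L.Term V) : (uLang R e).Term V :=
  (Language.LHom.sumInl : L →ᴸ uLang R e).onTerm t

/-- The term `U(w, x₁, …, xₘ)`, where `U` is the U-symbol of the condition `i` of `α` and
`x₁, …, xₘ` are the variables it stores. -/
def uTerm (R : Set (Rule L V)) (e : Enumeration V) (α : R) (i : Fin α.1.conds.length)
    (w : (uLang R e).Term V) : (uLang R e).Term V :=
  Language.Term.func (L := uLang R e) (Sum.inr (USymbol.mk α i))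
    (Fin.cons w fun j => Language.Term.var ((uVars e α.1 i).get j))

/-- The rules of the sequential unraveling of `R`. -/
inductive USeqRule (R : Set (Rule L V)) (e : Enumeration V) :
    (uLang R e).Term V × (uLang R e).Term V → Prop
  | uncond (α : R) (h : α.1.conds = []) : USeqRule R e (orig R e α.1.lhs, orig R e α.1.rhs)
  | intro (α : R) (i : Fin α.1.conds.length) (hi : (i : ℕ) = 0) :
      USeqRule R e (orig R e α.1.lhs, uTerm R e α i (orig R e (α.1.conds.get i).1))
  | switch (α : R) (i j : Fin α.1.conds.length) (hij : (j : ℕ) = i + 1) :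
      USeqRule R e (uTerm R e α i (orig R e (α.1.conds.get i).2),
        uTerm R e α j (orig R e (α.1.conds.get j).1))
  | elim (α : R) (i : Fin α.1.conds.length) (hi : (i : ℕ) + 1 = α.1.conds.length) :
      USeqRule R e (uTerm R e α i (orig R e (α.1.conds.get i).2), orig R e α.1.rhs)

/-- The sequential unraveling of `R`. -/
def USeq (R : Set (Rule L V)) (e : Enumeration V) :
    Set ((uLang R e).Term V × (uLang R e).Term V) :=
  {p | USeqRule R e p}

/-- The root case of the back-translation, applied to back-translated arguments. An original
symbol is kept; a U-symbol of `α` gives `lσ`, where `l` is the left-hand side of `α` and `σ` maps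
the `j`-th stored variable to the `j`-th variable argument (the conditional argument is dropped).
All variables of `l` are stored, so the value of `σ` at other variables is irrelevant. -/
def tbRoot (R : Set (Rule L V)) (e : Enumeration V) {n : ℕ} :
    L.Functions n ⊕ USymbol R e n → (Fin n → L.Term V) → L.Term V
  | Sum.inl f, ts => Language.Term.func f ts
  | Sum.inr (USymbol.mk α i), ts => α.1.lhs.subst fun x =>
      if h : (uVars e α.1 i).idxOf x < (uVars e α.1 i).length then
        ts (Fin.succ ⟨(uVars e α.1 i).idxOf x, h⟩)
      else Language.Term.var x

/-- The back-translation. -/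
def tb (R : Set (Rule L V)) (e : Enumeration V) : (uLang R e).Term V → L.Term V
  | .var x => Language.Term.var x
  | .func f ts => tbRoot R e f fun i => tb R e (ts i)

end Unraveling

end CTRS

/-! By termination and confluence `v` is the only normal form of `u`, so it suffices to follow one
convenient reduction, an innermost one. In it, the arguments stored by a U-symbol are normal forms
from the moment they are bound. They never change, so all conditions of a rule application are
evaluated under one and the same substitution. The invariant `Sound` records this, together with the
`R`-reductions that the conditional arguments have performed so far.

The back-translation sends every stage of a rule application to the same `lσ`. Hence `intro` and
`switch` steps and steps inside a conditional argument become equalities, while `elim` becomes an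
`R`-step whose conditions the invariant supplies. The weight is carried by `Sound.exists_root_step`
(innermost redexes) and `Sound.update` (contexts). -/

namespace CTRS

open FirstOrder

/-! ### Substitutions, normal forms and termination. -/

section Terms

variable {L : Language} {V : Type*}

theorem subst_congr [DecidableEq V] {W : Type*} (t : L.Term V) {σ τ : V → L.Term W}
    (h : ∀ x ∈ t.varFinset, σ x = τ x) : t.subst σ = t.subst τ := by
  induction t with
  | var x => exact h x (by simp [Language.Term.varFinset])
  | func f ts ih =>
    simp only [Language.Term.subst]
    congr 1
    funext i
    exact ih i fun x hx => h x (by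
      simp only [Language.Term.varFinset, Finset.mem_biUnion, Finset.mem_univ, true_and]
      exact ⟨i, hx⟩)

theorem subst_var (t : L.Term V) : t.subst Language.Term.var = t := by
  induction t with
  | var x => rfl
  | func f ts ih => simp only [Language.Term.subst, ih]

theorem Step.cases {S : Set (L.Term V × L.Term V)} {t t' : L.Term V} (h : Step S t t') :
    (∃ l r σ, (l, r) ∈ S ∧ t = l.subst σ ∧ t' = r.subst σ) ∨
      ∃ (n : ℕ) (f : L.Functions n) (ts : Fin n → L.Term V) (i : Fin n) (s : L.Term V),
        t = Language.Term.func f ts ∧ Step S (ts i) s := by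
  cases h with
  | rule h σ => exact .inl ⟨_, _, σ, h, rfl, rfl⟩
  | arg f ts i h => exact .inr ⟨_, f, ts, i, _, rfl, h⟩

theorem IsNormalForm.arg {S : Set (L.Term V × L.Term V)} {n : ℕ} {f : L.Functions n}
    {ts : Fin n → L.Term V} (h : IsNormalForm S (Language.Term.func f ts)) (i : Fin n) :
    IsNormalForm S (ts i) := fun _ hs => h _ (.arg f ts i hs)

theorem IsNormalForm.of_subst [DecidableEq V] {S : Set (L.Term V × L.Term V)} {t : L.Term V}
    {σ : V → L.Term V} (h : IsNormalForm S (t.subst σ)) {x : V} (hx : x ∈ t.varFinset) :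
    IsNormalForm S (σ x) := by
  induction t with
  | var y =>
    simp only [Language.Term.varFinset, Finset.mem_singleton] at hx
    subst hx
    exact h
  | func f ts ih =>
    simp only [Language.Term.varFinset, Finset.mem_biUnion, Finset.mem_univ, true_and] at hx
    obtain ⟨i, hi⟩ := hx
    exact ih i (IsNormalForm.arg (ts := fun i => (ts i).subst σ) h i) hi

theorem IsNormalForm.eq_of_steps {S : Set (L.Term V × L.Term V)} {t t' : L.Term V}
    (h : IsNormalForm S t) (hs : Steps S t t') : t' = t := by
  induction hs with
  | refl => rfl
  | tail _ h2 ih => subst ih; exact (h _ h2).elim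

theorem Terminating.acc {S : Set (L.Term V × L.Term V)} (h : Terminating S) (t : L.Term V) :
    Acc (fun a b => Step S b a) t := by
  by_contra hc
  obtain ⟨f, -, hf⟩ := not_acc_iff_exists_descending_chain.mp hc
  exact h ⟨f, hf⟩

theorem Step.mono {S S' : Set (L.Term V × L.Term V)} (hS : S ⊆ S') {s t : L.Term V}
    (h : Step S s t) : Step S' s t := by
  induction h with
  | rule h σ => exact .rule (hS h) σ
  | arg f ts i _ ih => exact .arg f ts i ih

theorem Steps.mono {S S' : Set (L.Term V × L.Term V)} (hS : S ⊆ S') {s t : L.Term V}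
    (h : Steps S s t) : Steps S' s t :=
  Relation.ReflTransGen.mono (fun _ _ => Step.mono hS) _ _ h

end Terms

/-! ### Conditional rewriting and the variables of deterministic rules. -/

section Conditional

variable {L : Language} {V : Type*} {R : Set (Rule L V)}

theorem level_subset_succ (R : Set (Rule L V)) (n : ℕ) : level R n ⊆ level R (n + 1) := by
  induction n with
  | zero => exact Set.empty_subset _
  | succ n ih =>
    rintro p ⟨α, hα, σ, rfl, hc⟩
    exact ⟨α, hα, σ, rfl, fun c h => (hc c h).mono ih⟩

theorem level_mono (R : Set (Rule L V)) : Monotone (level R) :=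
  monotone_nat_of_le_succ (level_subset_succ R)

theorem CSteps.exists_level {s t : L.Term V} (h : CSteps R s t) :
    ∃ n, Steps (level R n) s t := by
  induction h with
  | refl => exact ⟨0, .refl⟩
  | tail _ h2 ih =>
    obtain ⟨n, hn⟩ := ih
    obtain ⟨m, hm⟩ := h2
    exact ⟨max n m, (hn.mono (level_mono R (le_max_left n m))).tail
      (hm.mono (level_mono R (le_max_right n m)))⟩

/-- There are finitely many conditions and the levels increase, so a single level satisfies all of
them. -/
theorem CSteps.of_rule {α : Rule L V} (hα : α ∈ R) (σ : V → L.Term V)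
    (h : ∀ c ∈ α.conds, CSteps R (c.1.subst σ) (c.2.subst σ)) :
    CSteps R (α.lhs.subst σ) (α.rhs.subst σ) := by
  choose! n hn using fun c hc => (h c hc).exists_level
  obtain ⟨N, hN⟩ : ∃ N, ∀ c ∈ α.conds, n c ≤ N := by
    induction α.conds with
    | nil => exact ⟨0, by simp⟩
    | cons a l ih =>
      obtain ⟨N, hN⟩ := ih
      refine ⟨max (n a) N, ?_⟩
      simp only [List.mem_cons, forall_eq_or_imp]
      exact ⟨le_max_left _ _, fun c hc => (hN c hc).trans (le_max_right _ _)⟩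
  have hmem : (α.lhs.subst σ, α.rhs.subst σ) ∈ level R (N + 1) :=
    ⟨α, hα, σ, rfl, fun c hc => (hn c hc).mono (level_mono R (hN c hc))⟩
  -- Rules of a level are already instantiated, so the identity substitution is the right one.
  have hs := Step.rule hmem Language.Term.var
  refine .single ⟨N + 1, ?_⟩
  simpa only [subst_var] using hs

theorem CSteps.arg {n : ℕ} (f : L.Functions n) (ts : Fin n → L.Term V) (i : Fin n)
    {t' : L.Term V} (h : CSteps R (ts i) t') :
    CSteps R (Language.Term.func f ts) (Language.Term.func f (Function.update ts i t')) := by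
  induction h with
  | refl => rw [Function.update_eq_self]; exact .refl
  | @tail b c _ h2 ih =>
    obtain ⟨m, hm⟩ := h2
    refine ih.tail ⟨m, ?_⟩
    have := Step.arg (S := level R m) f (Function.update ts i b) i (t' := c) (by simpa using hm)
    simpa using this

variable [DecidableEq V]

theorem mem_foldr_snd {x : V} {l : List (L.Term V × L.Term V)} :
    x ∈ l.foldr (fun c X => c.2.varFinset ∪ X) ∅ ↔ ∃ c ∈ l, x ∈ c.2.varFinset := by
  induction l with
  | nil => simp
  | cons a l ih => simp [ih]

theorem mem_foldr_fst_snd {x : V} {l : List (L.Term V × L.Term V)} :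
    x ∈ l.foldr (fun c X => c.1.varFinset ∪ c.2.varFinset ∪ X) ∅ ↔
      ∃ c ∈ l, x ∈ c.1.varFinset ∨ x ∈ c.2.varFinset := by
  induction l with
  | nil => simp
  | cons a l ih => simp only [List.foldr_cons, Finset.mem_union, ih, List.exists_mem_cons_iff]

theorem Rule.mem_boundVars {α : Rule L V} {i : ℕ} {x : V} :
    x ∈ α.boundVars i ↔ x ∈ α.lhs.varFinset ∨
      ∃ j : Fin α.conds.length, (j : ℕ) < i ∧ x ∈ (α.conds.get j).2.varFinset := by
  simp only [Rule.boundVars, Finset.mem_union, mem_foldr_snd, List.mem_take_iff_getElem]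
  refine or_congr_right ⟨?_, ?_⟩
  · rintro ⟨c, ⟨j, hj, rfl⟩, hx⟩
    exact ⟨⟨j, (lt_min_iff.mp hj).2⟩, (lt_min_iff.mp hj).1, hx⟩
  · rintro ⟨j, hj, hx⟩
    exact ⟨_, ⟨j, lt_min hj j.2, rfl⟩, hx⟩

theorem Rule.boundVars_mono (α : Rule L V) : Monotone α.boundVars := by
  intro i j hij x hx
  rw [Rule.mem_boundVars] at hx ⊢
  exact hx.imp_right fun ⟨k, hk, h⟩ => ⟨k, hk.trans_le hij, h⟩

theorem Rule.snd_subset_boundVars (α : Rule L V) {i : ℕ} (j : Fin α.conds.length)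
    (h : (j : ℕ) < i) : (α.conds.get j).2.varFinset ⊆ α.boundVars i :=
  fun _ hx => Rule.mem_boundVars.mpr (.inr ⟨j, h, hx⟩)

theorem Rule.lhs_subset_boundVars (α : Rule L V) (i : ℕ) : α.lhs.varFinset ⊆ α.boundVars i :=
  fun _ hx => Rule.mem_boundVars.mpr (.inl hx)

theorem Rule.mem_boundVars_succ {α : Rule L V} (i : Fin α.conds.length) {x : V}
    (hx : x ∈ α.boundVars (i + 1)) :
    x ∈ α.boundVars i ∨ x ∈ (α.conds.get i).2.varFinset := by
  obtain h | ⟨j, hj, h⟩ := Rule.mem_boundVars.mp hx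
  · exact .inl (Rule.lhs_subset_boundVars α i h)
  · obtain hlt | heq := (Nat.lt_succ_iff.mp hj).lt_or_eq
    · exact .inl (Rule.snd_subset_boundVars α j hlt h)
    · obtain rfl := Fin.ext heq
      exact .inr h

/-- Determinism traces each variable of an `sᵢ` back to `l` or an earlier `tⱼ`, so the `sᵢ`
contribute no new variables. -/
theorem Rule.IsDeterministic.rhs_subset {α : Rule L V} (h : α.IsDeterministic) :
    α.rhs.varFinset ⊆ α.boundVars α.conds.length := by
  intro x hx
  obtain hc | hl := Finset.mem_union.mp (h.1 hx)
  · obtain ⟨c, hc, hx⟩ := mem_foldr_fst_snd.mp hc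
    obtain ⟨j, rfl⟩ := List.mem_iff_get.mp hc
    obtain hx | hx := hx
    · exact Rule.boundVars_mono α j.2.le (h.2 j hx)
    · exact Rule.snd_subset_boundVars α j j.2 hx
  · exact Rule.lhs_subset_boundVars α _ hl

end Conditional

/-! ### Back-translation and the invariant of innermost reductions. -/

section Unraveling

variable {L : Language} {V : Type*} [DecidableEq V] {R : Set (Rule L V)} {e : Enumeration V}

theorem tb_orig_subst (t : L.Term V) (σ : V → (uLang R e).Term V) :
    tb R e ((orig R e t).subst σ) = t.subst fun x => tb R e (σ x) := by
  induction t with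
  | var x => rfl
  | func f ts ih =>
    change Language.Term.func f (fun i => tb R e ((orig R e (ts i)).subst σ)) = _
    simp only [ih, Language.Term.subst]

theorem varFinset_orig (t : L.Term V) : (orig R e t).varFinset = t.varFinset := by
  induction t with
  | var x => rfl
  | func f ts ih =>
    change Finset.univ.biUnion (fun i => (orig R e (ts i)).varFinset) = _
    simp only [ih, Language.Term.varFinset]

theorem uTerm_subst (α : R) (i : Fin α.1.conds.length) (w : (uLang R e).Term V)
    (σ : V → (uLang R e).Term V) :
    (uTerm R e α i w).subst σ =
      Language.Term.func (L := uLang R e) (Sum.inr (USymbol.mk α i))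
        (Fin.cons (w.subst σ) fun j => σ ((uVars e α.1 i).get j)) := by
  simp only [uTerm, Language.Term.subst]
  congr 1
  funext j
  refine Fin.cases ?_ (fun j => ?_) j <;> rfl

theorem mem_uVars {α : Rule L V} {i : ℕ} {x : V} : x ∈ uVars e α i ↔ x ∈ α.boundVars i :=
  e.mem_list _ _

/-- Every variable of `l` is stored, so the default branch of `tbRoot` is never reached. The result
depends on neither `i` nor `w`, which makes `intro` and `switch` steps invisible. -/
theorem tb_uTerm_subst (α : R) (i : Fin α.1.conds.length) (w : (uLang R e).Term V)
    (σ : V → (uLang R e).Term V) :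
    tb R e ((uTerm R e α i w).subst σ) = α.1.lhs.subst fun x => tb R e (σ x) := by
  rw [uTerm_subst]
  refine subst_congr _ fun x hx => ?_
  have h := List.idxOf_lt_length_of_mem (mem_uVars (e := e).mpr (α.1.lhs_subset_boundVars i hx))
  rw [dif_pos h]
  beta_reduce
  rw [Fin.cons_succ, List.get_eq_getElem, List.getElem_idxOf]

/-- The root case of `Sound`: the variable arguments of a U-symbol are normal forms, and the
conditions that were already evaluated hold in `R` for the back-translated arguments. -/
def SoundRoot (R : Set (Rule L V)) (e : Enumeration V) {n : ℕ} :
    L.Functions n ⊕ USymbol R e n → (Fin n → (uLang R e).Term V) → Prop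
  | Sum.inl _, _ => True
  | Sum.inr (USymbol.mk α i), ts =>
      (∀ j, IsNormalForm (USeq R e) (ts (Fin.succ j))) ∧
      ∀ σ : V → L.Term V, (∀ j, σ ((uVars e α.1 i).get j) = tb R e (ts (Fin.succ j))) →
        (∀ j < i, CSteps R ((α.1.conds.get j).1.subst σ) ((α.1.conds.get j).2.subst σ)) ∧
        CSteps R ((α.1.conds.get i).1.subst σ) (tb R e (ts 0))

/-- The invariant of innermost reductions of the unraveled system: `SoundRoot` holds at every
position. -/
def Sound (R : Set (Rule L V)) (e : Enumeration V) : (uLang R e).Term V → Prop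
  | .var _ => True
  | .func f ts => SoundRoot R e f ts ∧ ∀ i, Sound R e (ts i)

/-- Original terms contain no U-symbols, so only the substituted parts carry obligations. -/
theorem sound_orig_subst {t : L.Term V} {σ : V → (uLang R e).Term V} :
    Sound R e ((orig R e t).subst σ) ↔ ∀ x ∈ t.varFinset, Sound R e (σ x) := by
  induction t with
  | var x =>
    simp only [Language.Term.varFinset, Finset.mem_singleton, forall_eq]
    rfl
  | func f ts ih =>
    change True ∧ (∀ i, Sound R e ((orig R e (ts i)).subst σ)) ↔ _
    simp only [ih, Language.Term.varFinset, Finset.mem_biUnion, Finset.mem_univ, true_and]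
    exact ⟨fun h x ⟨i, hx⟩ => h i x hx, fun h i x hx => h x ⟨i, hx⟩⟩

theorem sound_uTerm_subst {α : R} {i : Fin α.1.conds.length} {w : (uLang R e).Term V}
    {σ : V → (uLang R e).Term V} :
    Sound R e ((uTerm R e α i w).subst σ) ↔
      ((∀ x ∈ α.1.boundVars i, IsNormalForm (USeq R e) (σ x)) ∧
        ∀ τ : V → L.Term V, (∀ x ∈ α.1.boundVars i, τ x = tb R e (σ x)) →
          (∀ j < i, CSteps R ((α.1.conds.get j).1.subst τ) ((α.1.conds.get j).2.subst τ)) ∧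
          CSteps R ((α.1.conds.get i).1.subst τ) (tb R e (w.subst σ))) ∧
      Sound R e (w.subst σ) ∧ ∀ x ∈ α.1.boundVars i, Sound R e (σ x) := by
  have key : ∀ P : V → Prop, (∀ j, P ((uVars e α.1 i).get j)) ↔ ∀ x ∈ α.1.boundVars i, P x := by
    intro P
    refine ⟨fun h x hx => ?_, fun h j => h _ (mem_uVars.mp (List.get_mem _ _))⟩
    obtain ⟨j, rfl⟩ := List.mem_iff_get.mp (mem_uVars (e := e).mpr hx)
    exact h j
  rw [uTerm_subst]
  change SoundRoot R e (Sum.inr (USymbol.mk α i)) _ ∧ _ ↔ _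
  rw [Fin.forall_fin_succ]
  simp only [SoundRoot, Fin.cons_zero, Fin.cons_succ]
  rw [key fun x => IsNormalForm (USeq R e) (σ x), key fun x => Sound R e (σ x)]
  simp only [key fun x => _ = tb R e (σ x)]

/-- A redex whose proper subterms are normal forms can be contracted within the sound terms. -/
theorem Sound.exists_root_step (hdet : IsDCTRS R)
    (hvar : ∀ α ∈ R, ∀ x, α.lhs ≠ Language.Term.var x) {l r : (uLang R e).Term V}
    (hr : USeqRule R e (l, r)) {σ : V → (uLang R e).Term V} (hs : Sound R e (l.subst σ))
    (hnf : ∀ (n : ℕ) (f : (uLang R e).Functions n) (ts : Fin n → (uLang R e).Term V),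
      l.subst σ = Language.Term.func f ts → ∀ i, IsNormalForm (USeq R e) (ts i)) :
    Sound R e (r.subst σ) ∧ CSteps R (tb R e (l.subst σ)) (tb R e (r.subst σ)) := by
  -- As `l` is not a variable, each `σ x` lies inside a proper subterm of the redex.
  have hlhs : ∀ α ∈ R, l = orig R e α.lhs →
      ∀ x ∈ α.lhs.varFinset, IsNormalForm (USeq R e) (σ x) := by
    rintro α hα rfl x hx
    obtain ⟨lhs, rhs, conds⟩ := α
    cases lhs with
    | var y => exact (hvar _ hα y rfl).elim
    | func f ts =>
      simp only [Language.Term.varFinset, Finset.mem_biUnion, Finset.mem_univ, true_and] at hx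
      obtain ⟨i, hi⟩ := hx
      refine IsNormalForm.of_subst (t := orig R e (ts i))
        (hnf _ (Sum.inl f) (fun i => (orig R e (ts i)).subst σ) rfl i) ?_
      rwa [varFinset_orig]
  -- A variable bound after condition `i` is either stored already or matched by `tᵢ` inside the
  -- conditional argument, which is a normal form here.
  have hU : ∀ (α : R) (i : Fin α.1.conds.length),
      l = uTerm R e α i (orig R e (α.1.conds.get i).2) →
      ∀ x ∈ α.1.boundVars (i + 1), IsNormalForm (USeq R e) (σ x) ∧ Sound R e (σ x) := by
    rintro α i rfl x hx
    obtain ⟨⟨hN, -⟩, hw, hS⟩ := sound_uTerm_subst.mp hs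
    obtain hx | hx := Rule.mem_boundVars_succ i hx
    · exact ⟨hN x hx, hS x hx⟩
    · refine ⟨IsNormalForm.of_subst (t := orig R e (α.1.conds.get i).2)
        (hnf _ _ _ (uTerm_subst _ _ _ _) 0) ?_, sound_orig_subst.mp hw x hx⟩
      rwa [varFinset_orig]
  cases hr with
  | uncond α h =>
    have hd := (hdet _ α.2).rhs_subset
    have hb : α.1.boundVars α.1.conds.length = α.1.lhs.varFinset := by simp [Rule.boundVars, h]
    rw [hb] at hd
    refine ⟨sound_orig_subst.mpr fun x hx => sound_orig_subst.mp hs x (hd hx), ?_⟩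
    rw [tb_orig_subst, tb_orig_subst]
    exact CSteps.of_rule α.2 _ (by simp [h])
  | intro α i hi =>
    have hb : α.1.boundVars i = α.1.lhs.varFinset := by simp [Rule.boundVars, hi]
    have hS := sound_orig_subst.mp hs
    have hd := (hdet _ α.2).2 i
    rw [tb_orig_subst, tb_uTerm_subst]
    refine ⟨sound_uTerm_subst.mpr ⟨⟨?_, fun τ hτ => ⟨fun j hj => ?_, ?_⟩⟩, ?_, ?_⟩, .refl⟩
    · rw [hb]; exact hlhs _ α.2 rfl
    · have : (j : ℕ) < i := hj
      omega
    -- The evaluation of the condition starts here, with zero steps.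
    · rw [tb_orig_subst, subst_congr _ fun x hx => hτ x (hd hx)]
      exact .refl
    · exact sound_orig_subst.mpr fun x hx => hS x (hb ▸ hd hx)
    · rw [hb]; exact hS
  | switch α i j hij =>
    have hd := (hdet _ α.2).2 j
    have hv := hU α i rfl
    rw [← hij] at hv
    obtain ⟨⟨-, hC⟩, -, -⟩ := sound_uTerm_subst.mp hs
    rw [tb_uTerm_subst, tb_uTerm_subst]
    refine ⟨sound_uTerm_subst.mpr ⟨⟨fun x hx => (hv x hx).1, fun τ hτ => ⟨fun k hk => ?_, ?_⟩⟩,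
      ?_, fun x hx => (hv x hx).2⟩, .refl⟩
    · have hk : (k : ℕ) < j := hk
      have hle := α.1.boundVars_mono (show (i : ℕ) ≤ j by omega)
      obtain ⟨h1, h2⟩ := hC τ fun x hx => hτ x (hle hx)
      obtain hlt | heq := (show (k : ℕ) ≤ i by omega).lt_or_eq
      · exact h1 k hlt
      -- The condition just completed: its conditional argument has become an instance of `tᵢ`.
      · obtain rfl := Fin.ext heq
        rw [tb_orig_subst] at h2
        rwa [subst_congr (α.1.conds.get k).2 fun x hx =>
          hτ x (α.1.snd_subset_boundVars k hk hx)]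
    · rw [tb_orig_subst, subst_congr _ fun x hx => hτ x (hd hx)]
      exact .refl
    · exact sound_orig_subst.mpr fun x hx => (hv x (hd hx)).2
  | elim α i hi =>
    have hd := (hdet _ α.2).rhs_subset
    have hv := hU α i rfl
    rw [hi] at hv
    obtain ⟨⟨-, hC⟩, -, -⟩ := sound_uTerm_subst.mp hs
    rw [tb_uTerm_subst, tb_orig_subst]
    refine ⟨sound_orig_subst.mpr fun x hx => (hv x (hd hx)).2, CSteps.of_rule α.2 _ ?_⟩
    intro c hc
    obtain ⟨k, rfl⟩ := List.mem_iff_get.mp hc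
    obtain ⟨h1, h2⟩ := hC (fun x => tb R e (σ x)) fun x _ => rfl
    obtain hlt | heq := (show (k : ℕ) ≤ i by omega).lt_or_eq
    · exact h1 k hlt
    · obtain rfl := Fin.ext heq
      rwa [tb_orig_subst] at h2

/-- Contracting an argument that is not a stored normal form. -/
theorem Sound.update {n : ℕ} {f : (uLang R e).Functions n} {ts : Fin n → (uLang R e).Term V}
    (hs : Sound R e (Language.Term.func f ts)) {i : Fin n} {t' : (uLang R e).Term V}
    (hi : ¬ IsNormalForm (USeq R e) (ts i)) (ht : Sound R e t')
    (hc : CSteps R (tb R e (ts i)) (tb R e t')) :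
    Sound R e (Language.Term.func f (Function.update ts i t')) ∧
      CSteps R (tb R e (Language.Term.func f ts))
        (tb R e (Language.Term.func f (Function.update ts i t'))) := by
  have hargs : ∀ j, Sound R e (Function.update ts i t' j) := by
    intro j
    by_cases hj : j = i
    · subst hj; simpa using ht
    · simpa [hj] using hs.2 j
  rcases f with f | ⟨α, k⟩
  · refine ⟨⟨trivial, hargs⟩, ?_⟩
    have h : tb R e (Language.Term.func (L := uLang R e) (Sum.inl f) (Function.update ts i t')) =
        Language.Term.func f (Function.update (fun j => tb R e (ts j)) i (tb R e t')) :=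
      congrArg (Language.Term.func f)
        (funext fun j => Function.apply_update (fun _ => tb R e) ts i t' j)
    rw [h]
    exact CSteps.arg f (fun j => tb R e (ts j)) i hc
  · obtain ⟨hN, hC⟩ := hs.1
    -- Stored arguments are normal forms, so a reducible argument must be the conditional one.
    obtain rfl : i = 0 := by
      by_contra h
      obtain ⟨j, rfl⟩ := Fin.exists_succ_eq.mpr h
      exact hi (hN j)
    have hne : ∀ j : Fin (uVars e α.1 k).length, Function.update ts 0 t' j.succ = ts j.succ :=
      fun j => Function.update_of_ne (Fin.succ_ne_zero j) _ _
    refine ⟨⟨⟨fun j => ?_, fun σ hσ => ?_⟩, hargs⟩, ?_⟩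
    · rw [hne]; exact hN j
    · obtain ⟨h1, h2⟩ := hC σ fun j => by rw [hσ, hne]
      rw [Function.update_self]
      exact ⟨h1, h2.trans hc⟩
    -- The back-translation ignores the conditional argument, so both sides coincide.
    · change CSteps R (tbRoot R e (Sum.inr (USymbol.mk α k)) _)
        (tbRoot R e (Sum.inr (USymbol.mk α k)) _)
      simp only [tbRoot, hne]
      exact .refl

/-- Descending into reducible arguments as long as possible ends at an innermost redex;
`Sound.update` carries its contraction back up. -/
theorem Sound.exists_step (hdet : IsDCTRS R)
    (hvar : ∀ α ∈ R, ∀ x, α.lhs ≠ Language.Term.var x) {t : (uLang R e).Term V}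
    (hs : Sound R e t) (ht : ¬ IsNormalForm (USeq R e) t) :
    ∃ t', Step (USeq R e) t t' ∧ Sound R e t' ∧ CSteps R (tb R e t) (tb R e t') := by
  induction t with
  | var x =>
    simp only [IsNormalForm, not_forall, not_not] at ht
    obtain ⟨t', h⟩ := ht
    obtain ⟨l, r, σ, hr, hl, rfl⟩ | ⟨n, f, ts, i, s, h, -⟩ := h.cases
    · rw [hl] at hs ⊢
      exact ⟨_, .rule hr σ, Sound.exists_root_step hdet hvar hr hs
        fun n f ts h => by rw [← hl] at h; cases h⟩
    · cases h
  | func f ts ih =>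
    by_cases hargs : ∀ i, IsNormalForm (USeq R e) (ts i)
    · simp only [IsNormalForm, not_forall, not_not] at ht
      obtain ⟨t', h⟩ := ht
      have hnf : ∀ (n : ℕ) (g : (uLang R e).Functions n) (us : Fin n → (uLang R e).Term V),
          Language.Term.func f ts = Language.Term.func g us →
            ∀ i, IsNormalForm (USeq R e) (us i) := by
        intro n g us h
        cases h
        exact hargs
      obtain ⟨l, r, σ, hr, hl, rfl⟩ | ⟨n, g, us, i, s, h, hstep⟩ := h.cases
      · rw [hl] at hs hnf ⊢
        exact ⟨_, .rule hr σ, Sound.exists_root_step hdet hvar hr hs hnf⟩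
      · exact (hnf n g us h i s hstep).elim
    · push Not at hargs
      obtain ⟨i, hi⟩ := hargs
      obtain ⟨t', h1, h2, h3⟩ := ih i (hs.2 i) hi
      exact ⟨_, .arg f ts i h1, hs.update hi h2 h3⟩

theorem Sound.exists_normalForm (hdet : IsDCTRS R)
    (hvar : ∀ α ∈ R, ∀ x, α.lhs ≠ Language.Term.var x) (hterm : Terminating (USeq R e))
    {t : (uLang R e).Term V} (hs : Sound R e t) :
    ∃ v, Steps (USeq R e) t v ∧ IsNormalForm (USeq R e) v ∧
      CSteps R (tb R e t) (tb R e v) := by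
  induction hterm.acc t with
  | intro t _ ih =>
    by_cases ht : IsNormalForm (USeq R e) t
    · exact ⟨t, .refl, ht, .refl⟩
    · obtain ⟨t', h1, h2, h3⟩ := hs.exists_step hdet hvar ht
      obtain ⟨v, h4, h5, h6⟩ := ih t' h1 h2
      exact ⟨v, h4.head h1, h5, h3.trans h6⟩

/-- A rule with a variable as left-hand side would rewrite every term, including `v`. -/
theorem lhs_ne_var_of_isNormalForm {v : (uLang R e).Term V} (hv : IsNormalForm (USeq R e) v)
    {α : Rule L V} (hα : α ∈ R) (x : V) : α.lhs ≠ Language.Term.var x := by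
  intro hx
  have key : ∀ r, (orig R e α.lhs, r) ∈ USeq R e → False := by
    intro r hr
    have := Step.rule hr fun _ => v
    rw [hx] at this
    exact hv _ this
  by_cases h : α.conds = []
  · exact key _ (USeqRule.uncond ⟨α, hα⟩ h)
  · exact key _ (USeqRule.intro ⟨α, hα⟩ ⟨0, List.length_pos_iff.mpr h⟩ rfl)

end Unraveling

end CTRS

theorem mainTheorem4 {L : FirstOrder.Language} {V : Type*} [DecidableEq V] [Countable V]
    [Infinite V] (R : Set (CTRS.Rule L V)) (e : CTRS.Enumeration V)
    (hdet : CTRS.IsDCTRS R) (hstable : CTRS.IsRightStable R)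
    (hconf : CTRS.Confluent (CTRS.USeq R e)) (hterm : CTRS.Terminating (CTRS.USeq R e))
    (u : L.Term V) (v : (CTRS.uLang R e).Term V)
    (huv : CTRS.Steps (CTRS.USeq R e) (CTRS.orig R e u) v)
    (hv : CTRS.IsNormalForm (CTRS.USeq R e) v) :
    CTRS.CSteps R u (CTRS.tb R e v) := by
  have hs : CTRS.Sound R e (CTRS.orig R e u) := by
    rw [← CTRS.subst_var (CTRS.orig R e u)]
    exact CTRS.sound_orig_subst.mpr fun _ _ => trivial
  have htb : CTRS.tb R e (CTRS.orig R e u) = u := by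
    rw [← CTRS.subst_var (CTRS.orig R e u), CTRS.tb_orig_subst]
    exact CTRS.subst_var u
  obtain ⟨w, h1, h2, h3⟩ := hs.exists_normalForm hdet
    (fun _ hα x => CTRS.lhs_ne_var_of_isNormalForm hv hα x) hterm
  -- Both `v` and `w` are normal forms, so their common reduct `z` equals each of them.
  obtain ⟨z, hz1, hz2⟩ := hconf _ _ _ huv h1
  rw [htb, ← h2.eq_of_steps hz2, hv.eq_of_steps hz1] at h3
  exact h3
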